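/- Let $X=\{x_1,\dots,x_n\}$ be a finite set of states and consider a linear structured system with state matrix $A_\Lambda\in\mathbb R^{n\times n}$, whose entries are either fixed zeros or independent free parameters. Let $\mathcal A\subset X$ be a set of available nodes and $\mathcal T\subset X$ a set of $p=|\mathcal T|$ target nodes. For $\mathcal S\subset X$, let $\Sigma_{\mathcal S,\Lambda}$ be the structured system $\dot x=A_\Lambda x+B_{\mathcal S,\Lambda}u$, $y=C_{\mathcal T,\Lambda}x$, where $B_{\mathcal S,\Lambda}$ has one column for each node of $\mathcal S$, with a single free entry, in the row of this node, and $C_{\mathcal T,\Lambda}$ has one row for each node of $\mathcal T$, with a single free entry, in the column of this node; all free entries of the three matrices are independent real parameters, collected in the vector $\Lambda$. A property of $\Lambda$ is generic if it holds outside a proper algebraic variety, i.e. outside the common zero set of some nonempty family of nonzero real polynomials in the parameters. A system $\dot x=Ax+Bu$, $y=Cx$ is functionally output controllable if, for $x(0)=0$, every $T>0$ and every $C^\infty$ trajectory $\tilde y$ on $[0,T]$ with values in the output space and with $\tilde y^{(k)}(0)=0$ for all $k\ge 0$, there is an input $u\in C^\infty[0,T]$ such that $y(t)=\tilde y(t)$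 for all $t\in[0,T]$. A set $\mathcal S\subset\mathcal A$ is admissible if $\Sigma_{\mathcal S,\Lambda}$ is generically functionally output controllable. The Minimal Target Controllability Problem (MTCP) is to find an admissible set of minimum size; such a set is a solution, and the MTCP is solvable if a solution exists. Let $G$ be the directed graph of $\Sigma_{\mathcal A,\Lambda}$: its nodes are the states, inputs and outputs, and it has an edge from a node $i$ to a node $j$ whenever the entry in row $j$, column $i$ of the corresponding matrix is a free parameter. An $(\mathcal A$-$\mathcal T)$-linking in $G$ is a set of pairwise node-disjoint simple paths (paths of length $0$ are allowed), each starting in $\mathcal A$, ending in $\mathcal T$, and having its initial node as its only node in $\mathcal A$ and its terminal node as its only node in $\mathcal T$; its size is the number of its paths. Then the MTCP is solvable if and only if $G$ contains an $(\mathcal A$-$\mathcal T)$-linking of size $p$. When the MTCP is solvable, it has a solution with exactly $p$ steering nodes; more precisely, for every $(\mathcal A$-$\mathcal T)$-linking of size $p$, the set of the start nodes of its paths is a solution with exactly $p$ elements. -/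

import Mathlib

open scoped ContDiff

/-! ## Linear systems and functional output controllability -/

/-- `x` is the state trajectory on `[0, T]` of `ẋ = A x + B u` with `x 0 = 0`. -/
def IsZeroStateTrajectory {X U : Type*} [Fintype X] [Fintype U]
    (A : Matrix X X ℝ) (B : Matrix X U ℝ) (T : ℝ) (u : ℝ → U → ℝ) (x : ℝ → X → ℝ) : Prop :=
  x 0 = 0 ∧ ∀ t ∈ Set.Icc 0 T,
    HasDerivWithinAt x (A.mulVec (x t) + B.mulVec (u t)) (Set.Icc 0 T) t

/-- A reference trajectory for a system that starts at rest at time `0`: it is `C^∞` on `[0, T]`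
and all its derivatives, including the one of order `0`, vanish at time `0`. (Without a condition
at time `0` no system with at least one output could follow all trajectories, because `x 0 = 0`
forces `y 0 = 0`.) -/
def IsReferenceTrajectory {Y : Type*} [Fintype Y] (T : ℝ) (y : ℝ → Y → ℝ) : Prop :=
  ContDiffOn ℝ ∞ y (Set.Icc 0 T) ∧ ∀ k : ℕ, iteratedDerivWithin k y (Set.Icc 0 T) 0 = 0

/-- Functional output controllability of `ẋ = A x + B u`, `y = C x`: from `x 0 = 0`, on every
interval `[0, T]`, every reference trajectory is the output produced by some `C^∞` input. -/
def FunctionallyOutputControllable {X U Y : Type*} [Fintype X] [Fintype U] [Fintype Y]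
    (A : Matrix X X ℝ) (B : Matrix X U ℝ) (C : Matrix Y X ℝ) : Prop :=
  ∀ T : ℝ, 0 < T → ∀ yref : ℝ → Y → ℝ, IsReferenceTrajectory T yref →
    ∃ u : ℝ → U → ℝ, ContDiffOn ℝ ∞ u (Set.Icc 0 T) ∧
      ∃ x : ℝ → X → ℝ, IsZeroStateTrajectory A B T u x ∧
        ∀ t ∈ Set.Icc 0 T, C.mulVec (x t) = yref t

/-! ## Generic properties -/

/-- A proper algebraic variety in `ℝ^ι`: the common zero set of a nonempty family of nonzero
real polynomials. -/
def IsProperAlgebraicVariety {ι : Type*} (V : Set (ι → ℝ)) : Prop :=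
  ∃ Q : Set (MvPolynomial ι ℝ), Q.Nonempty ∧ (∀ q ∈ Q, q ≠ 0) ∧
    V = {v | ∀ q ∈ Q, MvPolynomial.eval v q = 0}

/-- A property of the parameter vector is generic if it holds outside a proper algebraic
variety. -/
def IsGeneric {ι : Type*} (P : (ι → ℝ) → Prop) : Prop :=
  ∃ V : Set (ι → ℝ), IsProperAlgebraicVariety V ∧ ∀ v, v ∉ V → P v

/-! ## Linear structured systems -/

/-- A linear structured system, given by the positions (row, column) of the entries of
`A`, `B`, `C` that are not fixed zeros. -/
structure StructuredSystem (X U Y : Type*) where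
  /-- positions of the free entries of the state matrix -/
  freeA : X → X → Prop
  /-- positions of the free entries of the input matrix -/
  freeB : X → U → Prop
  /-- positions of the free entries of the output matrix -/
  freeC : Y → X → Prop

namespace StructuredSystem

variable {X U Y : Type*}

/-- The index set of the parameters: one independent parameter for each free entry. -/
def ParamIndex (M : StructuredSystem X U Y) : Type _ :=
  {e : X × X // M.freeA e.1 e.2} ⊕ {e : X × U // M.freeB e.1 e.2} ⊕
    {e : Y × X // M.freeC e.1 e.2}

open Classical in
/-- The state matrix at the parameter vector `v`. -/
noncomputable def matA (M : StructuredSystem X U Y) (v : M.ParamIndex → ℝ) : Matrix X X ℝ :=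
  Matrix.of fun j i => if h : M.freeA j i then v (Sum.inl ⟨(j, i), h⟩) else 0

open Classical in
/-- The input matrix at the parameter vector `v`. -/
noncomputable def matB (M : StructuredSystem X U Y) (v : M.ParamIndex → ℝ) : Matrix X U ℝ :=
  Matrix.of fun j i => if h : M.freeB j i then v (Sum.inr (Sum.inl ⟨(j, i), h⟩)) else 0

open Classical in
/-- The output matrix at the parameter vector `v`. -/
noncomputable def matC (M : StructuredSystem X U Y) (v : M.ParamIndex → ℝ) : Matrix Y X ℝ :=
  Matrix.of fun j i => if h : M.freeC j i then v (Sum.inr (Sum.inr ⟨(j, i), h⟩)) else 0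

/-- Generic functional output controllability of a structured system. -/
def GenericallyFunctionallyOutputControllable [Fintype X] [Fintype U] [Fintype Y]
    (M : StructuredSystem X U Y) : Prop :=
  IsGeneric fun v : M.ParamIndex → ℝ =>
    FunctionallyOutputControllable (M.matA v) (M.matB v) (M.matC v)

/-- The directed graph of a structured system: the nodes are the states, the inputs and the
outputs, and there is an edge from `i` to `j` when the entry `(j, i)` of the corresponding
matrix is free. -/
def graph (M : StructuredSystem X U Y) : Digraph (X ⊕ U ⊕ Y) where
  Adj v w := match v, w with
    | Sum.inl i, Sum.inl j => M.freeA j i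
    | Sum.inr (Sum.inl i), Sum.inl j => M.freeB j i
    | Sum.inl i, Sum.inr (Sum.inr j) => M.freeC j i
    | _, _ => False

/-- The structured system with state pattern `E`, one input for each steering node in `S`,
acting on this node only, and one output for each target node in `T`, measuring this node
only. -/
def ofSteeringTarget (E : X → X → Prop) (S T : Finset X) : StructuredSystem X S T where
  freeA := E
  freeB := fun j i => j = i
  freeC := fun j i => i = j

end StructuredSystem

/-! ## Linkings -/

/-- `l` is the list of nodes covered by a simple direct `(V₁ - V₂)`-path of the directed graph
`G`: it starts in `V₁`, ends in `V₂`, does not meet a node twice, and its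
initial (terminal) node is its only node in `V₁` (in `V₂`). Paths of length `0` are the
one-element lists. -/
def IsSimpleDirectPath {V : Type*} (G : Digraph V) (V₁ V₂ : Set V) (l : List V) : Prop :=
  l.IsChain G.Adj ∧ l.Nodup ∧
    ∃ v₁ ∈ V₁, ∃ v₂ ∈ V₂, l.head? = some v₁ ∧ l.getLast? = some v₂ ∧
      (∀ w ∈ l, w ∈ V₁ → w = v₁) ∧ (∀ w ∈ l, w ∈ V₂ → w = v₂)

/-- A `(V₁ - V₂)`-linking: a set of simple direct `(V₁ - V₂)`-paths with no nodes in common.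
Its size is its cardinality. -/
def IsLinking {V : Type*} (G : Digraph V) (V₁ V₂ : Set V) (L : Finset (List V)) : Prop :=
  (∀ l ∈ L, IsSimpleDirectPath G V₁ V₂ l) ∧
    ∀ l ∈ L, ∀ l' ∈ L, l ≠ l' → ∀ w, w ∈ l → w ∉ l'

/-- The start nodes of the paths of a linking. -/
def startNodes {V : Type*} (L : Finset (List V)) : Set V :=
  {v | ∃ l ∈ L, l.head? = some v}

/-! ## The Minimal Target Controllability Problem -/

/-- `S` is an admissible set of steering nodes: it is taken from the available set `Av` and
makes the system with target set `T` generically functionally controllable. -/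
def IsAdmissibleSteeringSet {X : Type*} [Fintype X] (E : X → X → Prop) (Av T S : Finset X) :
    Prop :=
  S ⊆ Av ∧
    (StructuredSystem.ofSteeringTarget E S T).GenericallyFunctionallyOutputControllable

/-- `S` solves the Minimal Target Controllability Problem: it is an admissible set of steering
nodes of minimum size. -/
def IsMTCPSolution {X : Type*} [Fintype X] (E : X → X → Prop) (Av T S : Finset X) : Prop :=
  IsAdmissibleSteeringSet E Av T S ∧
    ∀ S' : Finset X, IsAdmissibleSteeringSet E Av T S' → S.card ≤ S'.card

/-- The Minimal Target Controllability Problem is solvable. -/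
def MTCPSolvable {X : Type*} [Fintype X] (E : X → X → Prop) (Av T : Finset X) : Prop :=
  ∃ S : Finset X, IsMTCPSolution E Av T S

/-- `L` is an `(Av - T)`-linking in the graph of the structured system with state pattern `E`,
input matrix related with `Av` and output matrix related with `T`. -/
def IsAvailableTargetLinking {X : Type*} (E : X → X → Prop) (Av T : Finset X)
    (L : Finset (List (X ⊕ Av ⊕ T))) : Prop :=
  IsLinking (StructuredSystem.ofSteeringTarget E Av T).graph
    (Sum.inl '' (Av : Set X)) (Sum.inl '' (T : Set X)) L

/-!
Everything goes through the polynomial system matrix `P(s) = [[A - s, B], [C, 0]]`.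

If `P` is square and `det P ≠ 0`, the system is functionally output controllable
(`functionallyOutputControllable_of_det_ne_zero`). Substituting `D = d/dt` for `s` turns the system
into `P(D) (x, u) = (0, y)`. A nonzero scalar operator `p(D)` maps the smooth functions that are
flat at `0` onto themselves, so one can solve `(det P)(D) z = (0, y)` and put
`(x, u) = (adj P)(D) z`. For a structured system, `det P(s)` at a fixed `s` is a polynomial in the
parameters, so one good parameter vector suffices for genericity. Given a linking of size `|T|`,
that vector has `1` on the edges of its paths and `0` on the other entries of `A`: at `s = 1` a
kernel vector of `P` is constant along each path, vanishes at its end, and so is zero.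

Conversely, functional output controllability makes the rows of `P` linearly independent over the
polynomials: a left null vector `(ξ, η)` would give a differential equation `η(D) y = 0` satisfied
by all reference trajectories, and those that are exponentials near some time exclude this unless
`η = 0`, and then `ξ (A - s) = 0` forces `ξ = 0`. By Hall's theorem the rows then have a system of
distinct columns with nonzero entries, that is, an injection `X ⊕ T → X ⊕ S` along edges and
diagonal entries. It gives `|T| ≤ |S|`, so that `|T|` steering nodes are optimal, and following it
backwards from each target until `Av` is met traces out a linking of size `|T|`, without Menger's
theorem.
-/

/-! ### Constant-coefficient operators on flat functions -/

/-- The complex-valued `C^∞` functions on `[0, T]` that are flat at `0`, each represented by the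
sequence of its successive derivatives. Carrying all derivatives as data makes differentiation the
shift of sequences, so no junk values of `derivWithin` occur. Values outside `[0, T]` are
unconstrained. -/
def flatJets (T : ℝ) : Submodule ℂ (ℕ → ℝ → ℂ) where
  carrier := {F | ∀ k, F k 0 = 0 ∧
    ∀ t ∈ Set.Icc 0 T, HasDerivWithinAt (F k) (F (k + 1) t) (Set.Icc 0 T) t}
  zero_mem' k := ⟨rfl, fun t _ => hasDerivWithinAt_const t _ 0⟩
  add_mem' {F G} hF hG k :=
    ⟨by simp [(hF k).1, (hG k).1], fun t ht => ((hF k).2 t ht).add ((hG k).2 t ht)⟩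
  smul_mem' c F hF k := ⟨by simp [(hF k).1], fun t ht => ((hF k).2 t ht).const_smul c⟩

namespace flatJets

variable {T : ℝ}

/-- Differentiation of flat functions: the shift of the sequence of derivatives. -/
def derivation (T : ℝ) : Module.End ℂ (flatJets T) where
  toFun F := ⟨fun k => F.1 (k + 1), fun k => F.2 (k + 1)⟩
  map_add' _ _ := rfl
  map_smul' _ _ := rfl

theorem contDiffOn (hT : 0 < T) (F : flatJets T) (k : ℕ) :
    ContDiffOn ℝ ∞ (F.1 k) (Set.Icc 0 T) := by
  refine contDiffOn_infty.2 fun n => ?_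
  induction n generalizing k with
  | zero => exact contDiffOn_zero.2 fun t ht => ((F.2 k).2 t ht).continuousWithinAt
  | succ n ih =>
    rw [Nat.cast_add, Nat.cast_one, contDiffOn_succ_iff_derivWithin (uniqueDiffOn_Icc hT)]
    refine ⟨fun t ht => ((F.2 k).2 t ht).differentiableWithinAt, by simp, ?_⟩
    exact (ih (k + 1)).congr fun t ht => ((F.2 k).2 t ht).derivWithin (uniqueDiffOn_Icc hT t ht)

theorem surjective_derivation_sub (hT : 0 < T) (a : ℂ) :
    Function.Surjective (derivation T - algebraMap ℂ (Module.End ℂ (flatJets T)) a) := by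
  intro F
  -- A continuous extension to the line lets the integral be differentiated at the end points too.
  let f : ℝ → ℂ := Set.IccExtend hT.le ((Set.Icc 0 T).domRestrict (F.1 0))
  have hf : Continuous f :=
    (continuousOn_iff_continuous_domRestrict.1
      fun t ht => ((F.2 0).2 t ht).continuousWithinAt).Icc_extend'
  have hfF : ∀ t ∈ Set.Icc 0 T, f t = F.1 0 t := fun t ht => Set.IccExtend_of_mem hT.le _ ht
  -- Variation of constants: `g` solves `g' = a g + f` with `g 0 = 0`; the equation itself then
  -- defines the higher derivatives.
  let g : ℝ → ℂ := fun t => Complex.exp (a * t) * ∫ s in (0 : ℝ)..t, Complex.exp (-(a * s)) * f s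
  have hg : ∀ t, HasDerivAt g (a * g t + f t) t := by
    intro t
    have h1 : HasDerivAt (fun t : ℝ => Complex.exp (a * t)) (Complex.exp (a * t) * (a * 1)) t :=
      ((Complex.ofRealCLM.hasDerivAt (x := t)).const_mul a).cexp
    have h2 : Continuous fun s : ℝ => Complex.exp (-(a * s)) * f s := by fun_prop
    have h3 := h1.mul (h2.integral_hasStrictDerivAt 0 t).hasDerivAt
    refine h3.congr_deriv ?_
    rw [← mul_assoc (Complex.exp (a * t)) (Complex.exp _), ← Complex.exp_add, add_neg_cancel,
      Complex.exp_zero]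
    simp only [g]
    ring
  let G : ℕ → ℝ → ℂ := fun k => k.rec g fun k Gk t => a * Gk t + F.1 k t
  have hG : G ∈ flatJets T := by
    intro k
    induction k with
    | zero =>
      refine ⟨by simp [G, g], fun t ht => ?_⟩
      have := (hg t).hasDerivWithinAt (s := Set.Icc 0 T)
      rwa [hfF t ht] at this
    | succ k ih =>
      refine ⟨?_, fun t ht => ((ih.2 t ht).const_mul a).add ((F.2 k).2 t ht)⟩
      change a * G k 0 + F.1 k 0 = 0
      rw [ih.1, (F.2 k).1, mul_zero, add_zero]
  refine ⟨⟨G, hG⟩, Subtype.ext ?_⟩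
  funext k t
  change a * G k t + F.1 k t - a * G k t = F.1 k t
  ring

/-- Every nonzero constant-coefficient differential operator maps the flat functions onto
themselves: over `ℂ` it is a product of first-order operators. -/
theorem surjective_aeval_derivation (hT : 0 < T) {p : Polynomial ℂ} (hp : p ≠ 0) :
    Function.Surjective (Polynomial.aeval (derivation T) p) := by
  induction hn : p.natDegree generalizing p with
  | zero =>
    obtain ⟨c, rfl⟩ := Polynomial.natDegree_eq_zero.1 hn
    have hc : c ≠ 0 := by simpa using hp
    intro F
    refine ⟨c⁻¹ • F, ?_⟩
    rw [Polynomial.aeval_C, Module.algebraMap_end_apply, smul_smul, mul_inv_cancel₀ hc, one_smul]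
  | succ n ih =>
    obtain ⟨a, ha⟩ := IsAlgClosed.exists_root p
      (by rw [Polynomial.degree_eq_natDegree hp, hn]; exact_mod_cast n.succ_ne_zero)
    obtain ⟨q, rfl⟩ := Polynomial.dvd_iff_isRoot.2 ha
    have hq : q ≠ 0 := right_ne_zero_of_mul hp
    rw [Polynomial.natDegree_mul (Polynomial.X_sub_C_ne_zero a) hq,
      Polynomial.natDegree_X_sub_C] at hn
    rw [map_mul, map_sub, Polynomial.aeval_X, Polynomial.aeval_C]
    exact (surjective_derivation_sub hT a).comp (ih hq (by omega))

end flatJets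

theorem IsReferenceTrajectory.mem_flatJets {Y : Type*} [Fintype Y] {T : ℝ} (hT : 0 < T)
    {y : ℝ → Y → ℝ} (hy : IsReferenceTrajectory T y) (j : Y) :
    (fun k t => (iteratedDerivWithin k y (Set.Icc 0 T) t j : ℂ)) ∈ flatJets T := by
  intro k
  refine ⟨by simp [hy.2 k], fun t ht => ?_⟩
  have h := (hy.1.differentiableOn_iteratedDerivWithin (m := k)
    (by exact_mod_cast WithTop.coe_lt_top _) (uniqueDiffOn_Icc hT) t ht).hasDerivWithinAt
  rw [← iteratedDerivWithin_succ] at h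
  exact (hasDerivWithinAt_pi.1 h j).ofReal_comp

/-! ### Controllability from a nonsingular system matrix -/

/-- A system whose square system matrix `[[A - s, B], [C, 0]]` is nonsingular at some real `s` is
functionally output controllable. The bijection `e` identifies inputs with outputs. -/
theorem functionallyOutputControllable_of_det_ne_zero {X U Y : Type*} [Fintype X] [Fintype U]
    [Fintype Y] [DecidableEq X] [DecidableEq Y] {A : Matrix X X ℝ} {B : Matrix X U ℝ}
    {C : Matrix Y X ℝ} (e : Y ≃ U) (s : ℝ)
    (h : (Matrix.fromBlocks (A - s • 1) (B.submatrix id e) C 0).det ≠ 0) :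
    FunctionallyOutputControllable A B C := by
  classical
  intro T hT y hy
  let c : ℝ →+* Polynomial ℂ := Polynomial.C.comp Complex.ofRealHom
  let P : Matrix (X ⊕ Y) (X ⊕ Y) (Polynomial ℂ) :=
    Matrix.fromBlocks (A.map c - (Polynomial.X : Polynomial ℂ) • 1)
      ((B.submatrix id e).map c) (C.map c) 0
  have hP : P.det ≠ 0 := by
    intro h0
    have h1 : P.map (Polynomial.evalRingHom (s : ℂ)) =
        (Matrix.fromBlocks (A - s • 1) (B.submatrix id e) C 0).map Complex.ofRealHom := by
      ext (i | i) (j | j)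
      · by_cases hij : i = j <;> simp [P, c, hij]
      all_goals simp [P, c]
    have h2 := congrArg (Polynomial.evalRingHom (s : ℂ)) h0
    rw [RingHom.map_det, RingHom.mapMatrix_apply, h1, map_zero, ← RingHom.mapMatrix_apply,
      ← RingHom.map_det] at h2
    exact h (by simpa using h2)
  let D := flatJets.derivation T
  choose z hz using fun j => flatJets.surjective_aeval_derivation hT hP ⟨_, hy.mem_flatJets hT j⟩
  -- `w = (adj P)(D) (0, z)`, hence `P(D) w = (det P)(D) (0, z) = (0, y)`. The coefficients of
  -- `P` are real, so real parts of `w` give the required state and input.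
  let w : X ⊕ Y → flatJets T := fun i => ∑ j, Polynomial.aeval D (P.adjugate i (Sum.inr j)) (z j)
  have hw : ∀ k, ∑ i, Polynomial.aeval D (P k i) (w i) =
      ∑ j, Polynomial.aeval D
        (P.det * (1 : Matrix (X ⊕ Y) (X ⊕ Y) (Polynomial ℂ)) k (Sum.inr j)) (z j) := by
    intro k
    simp only [w, map_sum]
    rw [Finset.sum_comm]
    refine Finset.sum_congr rfl fun j _ => ?_
    rw [← smul_eq_mul, ← Matrix.smul_apply, ← Matrix.mul_adjugate, Matrix.mul_apply, map_sum,
      LinearMap.sum_apply]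
    exact Finset.sum_congr rfl fun i _ => by rw [map_mul]; rfl
  have hc : ∀ (r : ℝ) (F : flatJets T), Polynomial.aeval D (c r) F = (r : ℂ) • F := fun r F => by
    exact (congrArg (fun f : Module.End ℂ (flatJets T) => f F)
      (Polynomial.aeval_C D (r : ℂ))).trans (Module.algebraMap_end_apply ..)
  have hite : ∀ (p : Prop) [Decidable p] (f : Module.End ℂ (flatJets T)) (F : flatJets T),
      (if p then f else 0) F = if p then f F else 0 := fun p _ f F => by split_ifs <;> rfl
  have hx : ∀ k, ∑ i, (A k i : ℂ) • w (Sum.inl i) - D (w (Sum.inl k)) +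
      ∑ j, (B k (e j) : ℂ) • w (Sum.inr j) = 0 := by
    intro k
    simpa [P, hc, hite, Fintype.sum_sum_type, Matrix.one_apply, Finset.sum_sub_distrib,
      apply_ite (Polynomial.aeval D)] using hw (Sum.inl k)
  have hCx : ∀ k, ∑ i, (C k i : ℂ) • w (Sum.inl i) = ⟨_, hy.mem_flatJets hT k⟩ := by
    intro k
    have h := hw (Sum.inr k)
    simp only [Matrix.one_apply, Sum.inr.injEq, mul_ite, mul_one, mul_zero,
      apply_ite (Polynomial.aeval D), map_zero, hite, Finset.sum_ite_eq, Finset.mem_univ,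
      if_true] at h
    rw [hz] at h
    simpa [P, hc, Fintype.sum_sum_type] using h
  refine ⟨fun t j => ((w (Sum.inr (e.symm j))).1 0 t).re, ?_,
    fun t i => ((w (Sum.inl i)).1 0 t).re, ⟨?_, fun t ht => ?_⟩, fun t ht => ?_⟩
  · exact contDiffOn_pi.2 fun j =>
      Complex.reCLM.contDiff.comp_contDiffOn (flatJets.contDiffOn hT _ 0)
  · funext i
    simp [((w (Sum.inl i)).2 0).1]
  · refine hasDerivWithinAt_pi.2 fun k => ?_
    have h1 := Complex.reCLM.hasFDerivAt.comp_hasDerivWithinAt t (((w (Sum.inl k)).2 0).2 t ht)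
    refine h1.congr_deriv ?_
    have h2 := congrArg (fun F : flatJets T => (F.1 0 t).re) (hx k)
    have h3 : ∑ j, B k j * ((w (Sum.inr (e.symm j))).1 0 t).re =
        ∑ j, B k (e j) * ((w (Sum.inr j)).1 0 t).re := by
      rw [← e.sum_comp]
      simp
    have h4 : ∀ F : flatJets T, (D F).1 0 t = F.1 1 t := fun _ => rfl
    simp [h4] at h2
    simp [Matrix.mulVec, dotProduct, h3]
    linarith
  · funext k
    simpa [Matrix.mulVec, dotProduct] using
      congrArg (fun F : flatJets T => (F.1 0 t).re) (hCx k)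

/-! ### The system matrix of a controllable system has independent rows -/

/-- The derivatives at a fixed time of suitable trajectories of a controllable system: they solve
the recursion `x (k + 1) = A x k + B u k`, and the output is `(d/dt)^k` of `exp (r t) w` at `t = 1`.
This reduces the differential system to a purely algebraic one. -/
theorem FunctionallyOutputControllable.exists_jets {X U Y : Type*} [Fintype X] [Fintype U]
    [Fintype Y] {A : Matrix X X ℝ} {B : Matrix X U ℝ} {C : Matrix Y X ℝ}
    (h : FunctionallyOutputControllable A B C) (r : ℝ) (w : Y → ℝ) :
    ∃ (x : ℕ → X → ℝ) (u : ℕ → U → ℝ), ∀ k, x (k + 1) = A.mulVec (x k) + B.mulVec (u k) ∧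
      C.mulVec (x k) = (r ^ k * Real.exp r) • w := by
  -- On `[0, 2]` this `y` vanishes up to time `1 / 4` and equals `exp (r t) w` from `1 / 2` on.
  let y : ℝ → Y → ℝ := fun t => (Real.smoothTransition (4 * t - 1) * Real.exp (r * t)) • w
  have hy : ContDiff ℝ ∞ y := by
    refine ContDiff.smul (f := fun t => Real.smoothTransition (4 * t - 1) * Real.exp (r * t))
      (ContDiff.mul ?_ ?_) contDiff_const
    · exact Real.smoothTransition.contDiff.comp (by fun_prop)
    · fun_prop
  have hy0 : IsReferenceTrajectory 2 y := by
    refine ⟨hy.contDiffOn, fun k => ?_⟩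
    have h0 : y =ᶠ[nhdsWithin 0 (Set.Icc 0 2)] fun _ => 0 := by
      refine nhdsWithin_le_nhds ?_
      filter_upwards [Iio_mem_nhds (show (0 : ℝ) < 1 / 4 by norm_num)] with t ht
      have ht : t < 1 / 4 := ht
      simp [y, Real.smoothTransition.zero_of_nonpos (show 4 * t - 1 ≤ 0 by linarith)]
    rw [h0.iteratedDerivWithin_eq (h0.self_of_nhdsWithin (by simp))]
    simp
  obtain ⟨u, hu, x, ⟨-, hx⟩, hxy⟩ := h 2 two_pos y hy0
  have hu' : ContDiffOn ℝ ∞ u (Set.Ioo 0 2) := hu.mono Set.Ioo_subset_Icc_self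
  let v : ℕ → ℝ → U → ℝ := fun k => iteratedDerivWithin k u (Set.Ioo 0 2)
  have hv : ∀ k, ∀ t ∈ Set.Ioo (0 : ℝ) 2, HasDerivAt (v k) (v (k + 1) t) t := by
    intro k t ht
    have h := (hu'.differentiableOn_iteratedDerivWithin (m := k)
      (by exact_mod_cast WithTop.coe_lt_top _) isOpen_Ioo.uniqueDiffOn t ht).hasDerivWithinAt
    rw [← iteratedDerivWithin_succ] at h
    exact h.hasDerivAt (isOpen_Ioo.mem_nhds ht)
  -- The derivatives of `x` are read off from the state equation, so that smoothness of `x` need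
  -- not be proved separately.
  let z : ℕ → ℝ → X → ℝ := fun k => k.rec x fun k zk t => A.mulVec (zk t) + B.mulVec (v k t)
  have hz : ∀ k, ∀ t ∈ Set.Ioo (0 : ℝ) 2, HasDerivAt (z k) (z (k + 1) t) t := by
    intro k
    induction k with
    | zero =>
      intro t ht
      have := (hx t (Set.Ioo_subset_Icc_self ht)).hasDerivAt (Icc_mem_nhds ht.1 ht.2)
      simpa [z, v] using this
    | succ k ih =>
      intro t ht
      exact (A.mulVecLin.toContinuousLinearMap.hasFDerivAt.comp_hasDerivAt t (ih t ht)).add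
        (B.mulVecLin.toContinuousLinearMap.hasFDerivAt.comp_hasDerivAt t (hv k t ht))
  have hzy : ∀ k, ∀ t ∈ Set.Ioo (1 / 2 : ℝ) 2,
      C.mulVec (z k t) = (r ^ k * Real.exp (r * t)) • w := by
    intro k
    induction k with
    | zero =>
      intro t ht
      have h1 := hxy t ⟨by linarith [ht.1], ht.2.le⟩
      simpa [y, z, Real.smoothTransition.one_of_one_le (show 1 ≤ 4 * t - 1 by linarith [ht.1])]
        using h1
    | succ k ih =>
      intro t ht
      have h1 := C.mulVecLin.toContinuousLinearMap.hasFDerivAt.comp_hasDerivAt t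
        (hz k t ⟨by linarith [ht.1], ht.2⟩)
      have h2 : HasDerivAt (fun t => (r ^ k * Real.exp (r * t)) • w)
          ((r ^ k * (Real.exp (r * t) * (r * 1))) • w) t :=
        ((((hasDerivAt_id t).const_mul r).exp).const_mul _).smul_const w
      have h3 := h1.unique (h2.congr_of_eventuallyEq
        (Filter.eventuallyEq_of_mem (isOpen_Ioo.mem_nhds ht) ih))
      refine h3.trans ?_
      congr 1
      ring
  refine ⟨fun k => z k 1, fun k => v k 1, fun k => ⟨rfl, ?_⟩⟩
  have := hzy k 1 ⟨by norm_num, by norm_num⟩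
  rwa [mul_one] at this

/-- The system matrix `[[A - s, B], [C, 0]]` (Rosenbrock matrix), with the polynomial variable
for `s`. -/
noncomputable def systemMatrix {X U Y : Type*} [DecidableEq X] (A : Matrix X X ℝ)
    (B : Matrix X U ℝ) (C : Matrix Y X ℝ) : Matrix (X ⊕ Y) (X ⊕ U) (Polynomial ℝ) :=
  Matrix.fromBlocks (A.map Polynomial.C - (Polynomial.X : Polynomial ℝ) • 1)
    (B.map Polynomial.C) (C.map Polynomial.C) 0

theorem FunctionallyOutputControllable.linearIndependent_systemMatrix {X U Y : Type*} [Fintype X]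
    [Fintype U] [Fintype Y] [DecidableEq X] {A : Matrix X X ℝ} {B : Matrix X U ℝ}
    {C : Matrix Y X ℝ} (h : FunctionallyOutputControllable A B C) :
    LinearIndependent (Polynomial ℝ) (systemMatrix A B C).row := by
  -- `L a p = ∑ n, p.coeff n * a n`: applied to the sequence of derivatives of `f` at a point,
  -- this is the value there of `p(D) f`.
  let L : (ℕ → ℝ) →ₗ[ℝ] Polynomial ℝ →ₗ[ℝ] ℝ :=
    ((Polynomial.basisMonomials ℝ).constr ℝ).toLinearMap
  have hL : ∀ a n, L a (Polynomial.monomial n 1) = a n := fun a n => by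
    have := (Polynomial.basisMonomials ℝ).constr_basis ℝ a n
    rwa [Polynomial.coe_basisMonomials] at this
  have hLX : ∀ a p, L a (Polynomial.X * p) = L (fun n => a (n + 1)) p := fun a p => by
    have : L a ∘ₗ LinearMap.mulLeft ℝ Polynomial.X = L fun n => a (n + 1) :=
      Polynomial.lhom_ext' fun n => LinearMap.ext_ring <| by
        simp [Polynomial.X_mul_monomial, hL]
    exact LinearMap.congr_fun this p
  have hLr : ∀ (r : ℝ) p, L (fun n => r ^ n) p = p.eval r := fun r p => by
    have : L (fun n => r ^ n) = Polynomial.leval r :=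
      Polynomial.lhom_ext' fun n => LinearMap.ext_ring <| by simp [hL]
    exact LinearMap.congr_fun this p
  have hLC : ∀ a p (c : ℝ), L a (p * Polynomial.C c) = c * L a p := fun a p c => by
    rw [mul_comm, ← Polynomial.smul_eq_C_mul, map_smul, smul_eq_mul]
  rw [Fintype.linearIndependent_iff]
  intro g hg
  -- The relation `g P = 0`, column by column.
  have hX : ∀ j, ∑ i, g (Sum.inl i) * Polynomial.C (A i j) +
      ∑ y, g (Sum.inr y) * Polynomial.C (C y j) = Polynomial.X * g (Sum.inl j) := by
    intro j
    have := congrFun hg (Sum.inl j)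
    simp [systemMatrix, Fintype.sum_sum_type, Matrix.one_apply, mul_sub,
      Finset.sum_sub_distrib] at this
    linear_combination this
  have hU : ∀ k, ∑ i, g (Sum.inl i) * Polynomial.C (B i k) = 0 := by
    intro k
    simpa [systemMatrix, Fintype.sum_sum_type] using congrFun hg (Sum.inr k)
  -- Pairing the columns with the derivatives of `x` and `u` leaves `exp r * g_y(r) = 0` for every
  -- `r` when the output is the exponential in direction `y`.
  have hY : ∀ y, g (Sum.inr y) = 0 := by
    classical
    intro y
    refine Polynomial.funext fun r => ?_
    obtain ⟨x, u, hxu⟩ := h.exists_jets r (Pi.single y 1)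
    have h1 : ∀ i p, ∑ j, A i j * L (fun n => x n j) p + ∑ k, B i k * L (fun n => u n k) p =
        L (fun n => x n i) (Polynomial.X * p) := by
      intro i p
      have : (fun n => x (n + 1) i) =
          ∑ j, A i j • (fun n => x n j) + ∑ k, B i k • (fun n => u n k) := by
        funext n
        simp [(hxu n).1, Matrix.mulVec, dotProduct]
      rw [hLX, this]
      simp
    have h2 : ∀ y' p, ∑ j, C y' j * L (fun n => x n j) p =
        Real.exp r * (Pi.single y 1 : Y → ℝ) y' * p.eval r := by
      intro y' p
      have : ∑ j, C y' j • (fun n => x n j) =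
          (Real.exp r * (Pi.single y 1 : Y → ℝ) y') • fun n => r ^ n := by
        funext n
        have := congrFun (hxu n).2 y'
        simp only [Matrix.mulVec, dotProduct, Pi.smul_apply, smul_eq_mul] at this
        simp only [Finset.sum_apply, Pi.smul_apply, smul_eq_mul, this]
        ring
      have := congrArg (fun a => L a p) this
      simpa [hLr] using this
    have h3 : ∑ j, L (fun n => x n j) (Polynomial.X * g (Sum.inl j)) =
        ∑ j, (∑ i, A i j * L (fun n => x n j) (g (Sum.inl i)) +
          ∑ y', C y' j * L (fun n => x n j) (g (Sum.inr y'))) :=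
      Finset.sum_congr rfl fun j _ => by rw [← hX, map_add, map_sum, map_sum]; simp only [hLC]
    have h4 : ∑ k, ∑ i, B i k * L (fun n => u n k) (g (Sum.inl i)) = 0 :=
      Finset.sum_eq_zero fun k _ => by
        simpa [hLC] using congrArg (L fun n => u n k) (hU k)
    simp only [← h1, Finset.sum_add_distrib] at h3
    rw [Finset.sum_comm] at h4
    rw [h4, Finset.sum_comm, add_zero, left_eq_add, Finset.sum_comm] at h3
    simp only [h2] at h3
    simpa [Pi.single_apply] using h3
  -- Now `g` restricted to the state rows is a left null vector of the characteristic matrix of `A`.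
  have h0 : (fun i => g (Sum.inl i)) = 0 := by
    refine Matrix.eq_zero_of_vecMul_eq_zero (M := A.charmatrix) A.charpoly_monic.ne_zero ?_
    funext j
    have := hX j
    simp [hY] at this
    simp [Matrix.vecMul, dotProduct, Matrix.charmatrix_apply, mul_sub, Finset.sum_sub_distrib,
      this, Matrix.diagonal_apply]
    ring
  rintro (i | y)
  · exact congrFun h0 i
  · exact hY y

/-- A matrix with independent rows has nonzero entries in distinct columns, one for each row.
Hall's condition holds because the rows in a set `s` are supported on the columns of its
neighbourhood, hence are at most as many. -/
theorem exists_injective_of_linearIndependent_row {m n R : Type*} [Fintype m] [Fintype n]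
    [CommRing R] [Nontrivial R] {M : Matrix m n R} (h : LinearIndependent R M.row) :
    ∃ f : m → n, Function.Injective f ∧ ∀ i, M i (f i) ≠ 0 := by
  classical
  obtain ⟨f, hf, hfM⟩ := (Finset.all_card_le_biUnion_card_iff_exists_injective
    fun i => Finset.univ.filter fun j => M i j ≠ 0).1 fun s => by
      let N := s.biUnion fun i => Finset.univ.filter fun j => M i j ≠ 0
      let g : (N → R) →ₗ[R] n → R := Function.ExtendByZero.linearMap R Subtype.val
      have h1 : LinearIndependent R fun i : s => fun j : N => M i j := by
        refine LinearIndependent.of_comp g ?_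
        convert h.comp (Subtype.val : s → m) Subtype.val_injective using 1
        funext i j
        by_cases hj : j ∈ N
        · exact Subtype.val_injective.extend_apply (fun j : N => M i j) (0 : n → R) ⟨j, hj⟩
        · have h0 : M i j = 0 := by
            by_contra h0
            exact hj (Finset.mem_biUnion.2 ⟨i, i.2, by simpa using h0⟩)
          exact (Function.extend_apply' (fun j : N => M i j) (0 : n → R) j
            (fun ⟨a, ha⟩ => hj (ha ▸ a.2))).trans h0.symm
      simpa using h1.fintype_card_le_finrank
  exact ⟨f, hf, fun i => by simpa using hfM i⟩

/-! ### Generic properties of structured systems -/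

theorem IsGeneric.exists {ι : Type*} {P : (ι → ℝ) → Prop} (h : IsGeneric P) : ∃ v, P v := by
  obtain ⟨V, ⟨Q, ⟨q, hq⟩, hQ, rfl⟩, hP⟩ := h
  obtain ⟨v, hv⟩ : ∃ v, MvPolynomial.eval v q ≠ 0 := by
    by_contra! h0
    exact hQ q hq (MvPolynomial.funext fun v => by rw [h0 v, map_zero])
  exact ⟨v, hP v fun h0 => hv (h0 q hq)⟩

theorem isGeneric_of_forall_eval_ne_zero {ι : Type*} {P : (ι → ℝ) → Prop} {q : MvPolynomial ι ℝ}
    {v₀ : ι → ℝ} (hq : MvPolynomial.eval v₀ q ≠ 0) (h : ∀ v, MvPolynomial.eval v q ≠ 0 → P v) :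
    IsGeneric P :=
  ⟨_, ⟨{q}, Set.singleton_nonempty q, by rintro _ rfl rfl; simp at hq, rfl⟩,
    fun v hv => h v fun h0 => hv (by simpa using h0)⟩

/-- It suffices to find one parameter vector with nonsingular system matrix at one `s`, since the
determinant at this `s` is a polynomial in the parameters. -/
theorem StructuredSystem.genericallyFunctionallyOutputControllable_of_det_ne_zero
    {X U Y : Type*} [Fintype X] [Fintype U] [Fintype Y] [DecidableEq X] [DecidableEq Y]
    (M : StructuredSystem X U Y) (e : Y ≃ U) (s : ℝ) (v₀ : M.ParamIndex → ℝ)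
    (h : (Matrix.fromBlocks (M.matA v₀ - s • 1) ((M.matB v₀).submatrix id e)
      (M.matC v₀) 0).det ≠ 0) :
    M.GenericallyFunctionallyOutputControllable := by
  classical
  let A : Matrix X X (MvPolynomial M.ParamIndex ℝ) :=
    Matrix.of fun j i => if h : M.freeA j i then .X (Sum.inl ⟨(j, i), h⟩) else 0
  let B : Matrix X U (MvPolynomial M.ParamIndex ℝ) :=
    Matrix.of fun j i => if h : M.freeB j i then .X (Sum.inr (Sum.inl ⟨(j, i), h⟩)) else 0
  let C : Matrix Y X (MvPolynomial M.ParamIndex ℝ) :=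
    Matrix.of fun j i => if h : M.freeC j i then .X (Sum.inr (Sum.inr ⟨(j, i), h⟩)) else 0
  let P : Matrix (X ⊕ Y) (X ⊕ Y) (MvPolynomial M.ParamIndex ℝ) :=
    Matrix.fromBlocks (A - (MvPolynomial.C s : MvPolynomial M.ParamIndex ℝ) • 1)
      (B.submatrix id e) C 0
  have hP : ∀ v, MvPolynomial.eval v P.det =
      (Matrix.fromBlocks (M.matA v - s • 1) ((M.matB v).submatrix id e) (M.matC v) 0).det := by
    intro v
    rw [RingHom.map_det]
    congr 1
    ext (i | i) (j | j)
    · by_cases hij : i = j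
      · subst hij
        by_cases hf : M.freeA i i <;> simp [P, A, matA, hf]
        exact MvPolynomial.eval_X _
      · by_cases hf : M.freeA i j <;> simp [P, A, matA, hf, hij]
        exact MvPolynomial.eval_X _
    · by_cases hf : M.freeB i (e j) <;> simp [P, B, matB, hf]
      exact MvPolynomial.eval_X _
    · by_cases hf : M.freeC i j <;> simp [P, C, matC, hf]
      exact MvPolynomial.eval_X _
    · simp [P]
  refine isGeneric_of_forall_eval_ne_zero (q := P.det) (v₀ := v₀) (by rwa [hP]) fun v hv => ?_
  rw [hP] at hv
  exact functionallyOutputControllable_of_det_ne_zero e s hv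

/-! ### From controllability to linkings -/

/-- An injection from the rows to the columns of the system matrix that picks only diagonal
entries and entries not fixed to zero contains a linking covering the target set: start at
`f (Sum.inr t) = Sum.inl t` and iterate `f` backwards along edges until `Av` is reached. -/
theorem exists_linking_of_injective {X : Type*} [Finite X] {E : X → X → Prop} {Av T S : Finset X}
    (hS : S ⊆ Av) {f : X ⊕ T → X ⊕ S} (hf : Function.Injective f)
    (hE : ∀ j i, f (Sum.inl j) = Sum.inl i → i = j ∨ E j i)
    (hB : ∀ j s, f (Sum.inl j) = Sum.inr s → j = s)
    (hC : ∀ t, f (Sum.inr t) = Sum.inl t.1) :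
    ∃ L : Finset (List (X ⊕ Av ⊕ T)), IsAvailableTargetLinking E Av T L ∧ L.card = T.card := by
  classical
  -- The value of `pred` at a node sent to an input is irrelevant: such a node lies in `S ⊆ Av`.
  let pred : X → X := fun j => (f (Sum.inl j)).elim id fun _ => j
  let a : T → ℕ → X := fun t k => pred^[k] t
  -- `r t k` is the row whose column under `f` is `a t k`, as long as the orbit has not met `Av`
  -- before.
  let r : T → ℕ → X ⊕ T := fun t k => k.rec (Sum.inr t) fun k _ => Sum.inl (a t k)
  have hpred : ∀ j ∉ Av, f (Sum.inl j) = Sum.inl (pred j) := by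
    intro j hj
    rcases hfj : f (Sum.inl j) with i | s
    · simp [pred, hfj]
    · exact absurd (hS (hB j s hfj ▸ s.2)) hj
  have ha : ∀ t k, a t (k + 1) = pred (a t k) := fun t k => Function.iterate_succ_apply' _ _ _
  have hr : ∀ t k, (∀ i < k, a t i ∉ Av) → f (r t k) = Sum.inl (a t k) := by
    intro t k hk
    cases k with
    | zero => exact hC t
    | succ k => rw [ha]; exact hpred _ (hk k k.lt_succ_self)
  -- Backward orbits that have not met `Av` before cannot merge or repeat, by injectivity of `f` and
  -- since the rows `Sum.inr t` come first.
  have hinj : ∀ t t' i j, (∀ k < i, a t k ∉ Av) → (∀ k < j, a t' k ∉ Av) → a t i = a t' j →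
      t = t' ∧ i = j := by
    intro t t' i
    induction i with
    | zero =>
      intro j h h' haa
      have h1 : r t 0 = r t' j := hf (by rw [hr t 0 h, hr t' j h', haa])
      cases j with
      | zero => exact ⟨Sum.inr_injective h1, rfl⟩
      | succ j => cases h1
    | succ i ih =>
      intro j h h' haa
      have h1 : r t (i + 1) = r t' j := hf (by rw [hr t _ h, hr t' j h', haa])
      cases j with
      | zero => cases h1
      | succ j =>
        obtain ⟨h2, h3⟩ := ih j (fun k hk => h k (by omega)) (fun k hk => h' k (by omega))
          (Sum.inl_injective h1)
        exact ⟨h2, by rw [h3]⟩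
  have hex : ∀ t, ∃ k, a t k ∈ Av := by
    intro t
    by_contra! h
    exact not_injective_infinite_finite (a t) fun i j hij =>
      (hinj t t i j (fun k _ => h k) (fun k _ => h k) hij).2
  let N : T → ℕ := fun t => Nat.find (hex t)
  have hN : ∀ t, a t (N t) ∈ Av := fun t => Nat.find_spec (hex t)
  have hlt : ∀ t, ∀ k < N t, a t k ∉ Av := fun t k hk => Nat.find_min (hex t) hk
  have hinj' : ∀ t t' i j, i ≤ N t → j ≤ N t' → a t i = a t' j → t = t' ∧ i = j :=
    fun t t' i j hi hj => hinj t t' i j (fun k hk => hlt t k (by omega))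
      (fun k hk => hlt t' k (by omega))
  have hadj : ∀ t, ∀ k < N t, E (a t k) (a t (k + 1)) := by
    intro t k hk
    have h1 := hpred _ (hlt t k hk)
    rw [← ha] at h1
    -- The diagonal case would make the orbit stationary, against `hinj'`.
    refine (hE _ _ h1).resolve_left fun h2 => ?_
    have := (hinj' t t (k + 1) k hk hk.le h2).2
    omega
  let l : T → List (X ⊕ Av ⊕ T) := fun t =>
    ((List.range (N t + 1)).map fun k => Sum.inl (a t k)).reverse
  have hl : ∀ t w, w ∈ l t ↔ ∃ k ≤ N t, Sum.inl (a t k) = w := by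
    intro t w
    simp [l]
  have hlinj : Function.Injective l := by
    intro t t' h
    have h1 : Sum.inl (a t 0) ∈ l t' := h ▸ (hl t _).2 ⟨0, Nat.zero_le _, rfl⟩
    obtain ⟨k, hk, h2⟩ := (hl t' _).1 h1
    exact (hinj' t' t k 0 hk (Nat.zero_le _) (Sum.inl_injective h2)).1.symm
  refine ⟨Finset.univ.image l, ⟨?_, ?_⟩, ?_⟩
  · simp only [Finset.mem_image, Finset.mem_univ, true_and, forall_exists_index,
      forall_apply_eq_imp_iff]
    intro t
    refine ⟨?_, ?_, Sum.inl (a t (N t)), ⟨_, hN t, rfl⟩, Sum.inl t, ⟨_, t.2, rfl⟩, ?_, ?_, ?_, ?_⟩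
    · rw [List.isChain_reverse, List.isChain_map, List.isChain_iff_getElem]
      intro i hi
      simp only [List.getElem_range]
      exact hadj t i (by simpa using hi)
    · rw [List.nodup_reverse]
      refine List.Nodup.map_on ?_ List.nodup_range
      intro i hi j hj hij
      exact (hinj' t t i j (Nat.lt_succ_iff.1 (List.mem_range.1 hi))
        (Nat.lt_succ_iff.1 (List.mem_range.1 hj)) (Sum.inl_injective hij)).2
    · simp [l, List.range_succ]
    · simp [l, List.range_succ_eq_map, a]
    · intro w hw hwA
      obtain ⟨k, hk, rfl⟩ := (hl t w).1 hw
      obtain ⟨x, hx, hxa⟩ := hwA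
      rw [Sum.inl_injective hxa] at hx
      rcases hk.lt_or_eq with h | h
      · exact absurd hx (hlt t k h)
      · rw [h]
    · intro w hw hwT
      obtain ⟨k, hk, rfl⟩ := (hl t w).1 hw
      obtain ⟨x, hx, hxa⟩ := hwT
      have h1 := hinj' t ⟨x, hx⟩ k 0 hk (Nat.zero_le _) (Sum.inl_injective hxa).symm
      rw [h1.2]; rfl
  · simp only [Finset.mem_image, Finset.mem_univ, true_and, forall_exists_index,
      forall_apply_eq_imp_iff]
    intro t t' hne w hw hw'
    obtain ⟨i, hi, rfl⟩ := (hl t w).1 hw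
    obtain ⟨j, hj, hij⟩ := (hl t' _).1 hw'
    exact hne (congrArg l (hinj' t t' i j hi hj (Sum.inl_injective hij).symm).1)
  · rw [Finset.card_image_of_injective _ hlinj, Finset.card_univ, Fintype.card_coe]

/-- Hall's theorem for the system matrix at a parameter vector where the system is
controllable. -/
theorem IsAdmissibleSteeringSet.exists_injective {X : Type*} [Fintype X] {E : X → X → Prop}
    {Av T S : Finset X} (h : IsAdmissibleSteeringSet E Av T S) :
    ∃ f : X ⊕ T → X ⊕ S, Function.Injective f ∧
      (∀ j i, f (Sum.inl j) = Sum.inl i → i = j ∨ E j i) ∧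
      (∀ j s, f (Sum.inl j) = Sum.inr s → j = s) ∧
      (∀ t, f (Sum.inr t) = Sum.inl t.1) := by
  classical
  obtain ⟨v, hv⟩ := h.2.exists
  obtain ⟨f, hf, hne⟩ := exists_injective_of_linearIndependent_row hv.linearIndependent_systemMatrix
  refine ⟨f, hf, fun j i hji => ?_, fun j s hjs => ?_, fun t => ?_⟩
  · have := hne (Sum.inl j)
    rw [hji] at this
    by_contra! hcon
    simp [systemMatrix, StructuredSystem.matA, StructuredSystem.ofSteeringTarget, hcon.1.symm,
      hcon.2] at this
  · have := hne (Sum.inl j)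
    rw [hjs] at this
    by_contra hcon
    simp [systemMatrix, StructuredSystem.matB, StructuredSystem.ofSteeringTarget, hcon] at this
  · have := hne (Sum.inr t)
    rcases hft : f (Sum.inr t) with i | s
    · rw [hft] at this
      by_contra hcon
      have hcon : ¬ (t : X) = i := fun h => hcon (by rw [h])
      simp [systemMatrix, StructuredSystem.matC, StructuredSystem.ofSteeringTarget, 
        Ne.symm hcon] at this
    · rw [hft] at this
      simp [systemMatrix] at this

theorem IsAdmissibleSteeringSet.card_le {X : Type*} [Fintype X] {E : X → X → Prop}
    {Av T S : Finset X} (h : IsAdmissibleSteeringSet E Av T S) : T.card ≤ S.card := by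
  obtain ⟨f, hf, -⟩ := h.exists_injective
  simpa using Fintype.card_le_of_injective f hf

theorem IsAdmissibleSteeringSet.exists_linking {X : Type*} [Fintype X] {E : X → X → Prop}
    {Av T S : Finset X} (h : IsAdmissibleSteeringSet E Av T S) :
    ∃ L : Finset (List (X ⊕ Av ⊕ T)), IsAvailableTargetLinking E Av T L ∧ L.card = T.card := by
  obtain ⟨f, hf, hE, hB, hC⟩ := h.exists_injective
  exact exists_linking_of_injective h.1 hf hE hB hC

/-! ### From linkings to controllability -/

/-- A path between states runs through states only: inputs have no incoming edges and outputs no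
outgoing ones. -/
theorem StructuredSystem.exists_eq_inl_of_isChain {X U Y : Type*} {M : StructuredSystem X U Y}
    {l : List (X ⊕ U ⊕ Y)} {a b : X} (hl : l.IsChain M.graph.Adj)
    (ha : l.head? = some (Sum.inl a)) (hb : l.getLast? = some (Sum.inl b)) :
    ∀ w ∈ l, ∃ x, w = Sum.inl x := by
  intro w hw
  obtain ⟨k, hk, rfl⟩ := List.mem_iff_getElem.1 hw
  rw [List.isChain_iff_getElem] at hl
  rcases hkw : l[k] with x | u | y
  · exact ⟨x, rfl⟩
  · cases k with
    | zero =>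
      rw [List.head?_eq_getElem?, List.getElem?_eq_getElem hk, hkw] at ha
      simp at ha
    | succ k =>
      have := hl k hk
      rw [hkw] at this
      rcases hk' : l[k] with _ | _ | _ <;> rw [hk'] at this <;> exact this.elim
  · by_cases hk' : k + 1 < l.length
    · have := hl k hk'
      rw [hkw] at this
      exact this.elim
    · rw [List.getLast?_eq_getElem?, show l.length - 1 = k by omega,
        List.getElem?_eq_getElem hk, hkw] at hb
      simp at hb

/-- The start nodes of a linking as large as the target set steer all targets. -/
theorem IsAvailableTargetLinking.exists_admissible {X : Type*} [Fintype X] {E : X → X → Prop}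
    {Av T : Finset X} {L : Finset (List (X ⊕ Av ⊕ T))} (hL : IsAvailableTargetLinking E Av T L)
    (hcard : L.card = T.card) :
    ∃ S : Finset X, Sum.inl '' (S : Set X) = startNodes L ∧
      IsAdmissibleSteeringSet E Av T S ∧ S.card = T.card := by
  classical
  obtain ⟨hpath, hdisj⟩ := hL
  have hdata : ∀ l ∈ L, ∃ a ∈ Av, ∃ b ∈ T, l.head? = some (Sum.inl a) ∧
      l.getLast? = some (Sum.inl b) := by
    intro l hl
    obtain ⟨-, -, _, ⟨a, ha, rfl⟩, _, ⟨b, hb, rfl⟩, h1, h2, -⟩ := hpath l hl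
    exact ⟨a, ha, b, hb, h1, h2⟩
  choose s hsA t htT hs ht using hdata
  have hdisj' : ∀ l ∈ L, ∀ l' ∈ L, ∀ w, w ∈ l → w ∈ l' → l = l' := fun l hl l' hl' w h h' =>
    by_contra fun hne => hdisj l hl l' hl' hne w h h'
  have hinl : ∀ l ∈ L, ∀ w ∈ l, ∃ x, w = Sum.inl x := fun l hl =>
    StructuredSystem.exists_eq_inl_of_isChain (hpath l hl).1 (hs l hl) (ht l hl)
  have hsmem : ∀ l (hl : l ∈ L), Sum.inl (s l hl) ∈ l := fun l hl => List.mem_of_head? (hs l hl)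
  let S : Finset X := L.attach.image fun l => s l.1 l.2
  have hS : ∀ x, x ∈ S ↔ ∃ l, ∃ hl : l ∈ L, s l hl = x := by simp [S]
  have hScard : S.card = T.card := by
    rw [← hcard, ← Finset.card_attach (s := L)]
    refine Finset.card_image_of_injective _ fun l l' h => Subtype.ext ?_
    refine hdisj' _ l.2 _ l'.2 (Sum.inl (s l.1 l.2)) (hsmem _ _) ?_
    rw [h]
    exact hsmem _ _
  refine ⟨S, ?_, ⟨fun x hx => ?_, ?_⟩, hScard⟩
  · ext w
    constructor
    · rintro ⟨x, hx, rfl⟩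
      obtain ⟨l, hl, rfl⟩ := (hS x).1 hx
      exact ⟨l, hl, hs l hl⟩
    · rintro ⟨l, hl, hw⟩
      exact ⟨s l hl, (hS _).2 ⟨l, hl, rfl⟩, Option.some_injective _ ((hs l hl).symm.trans hw)⟩
  · obtain ⟨l, hl, rfl⟩ := (hS x).1 hx
    exact hsA l hl
  -- `R i j`: the edge from `i` to `j` is used by the linking.
  let R : X → X → Prop := fun i j =>
    ∃ l ∈ L, ∃ k : ℕ, l[k]? = some (Sum.inl i) ∧ l[k + 1]? = some (Sum.inl j)
  have hRE : ∀ i j, R i j → E j i := by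
    rintro i j ⟨l, hl, k, hi, hj⟩
    obtain ⟨h1, h2⟩ := List.getElem?_eq_some_iff.1 hi
    obtain ⟨h3, h4⟩ := List.getElem?_eq_some_iff.1 hj
    have := List.isChain_iff_getElem.1 (hpath l hl).1 k h3
    rw [h2, h4] at this
    exact this
  let M := StructuredSystem.ofSteeringTarget E S T
  let v : M.ParamIndex → ℝ := Sum.elim (fun e => if R e.1.2 e.1.1 then 1 else 0) fun _ => 1
  let e : T ≃ S := Finset.equivOfCardEq hScard.symm
  refine M.genericallyFunctionallyOutputControllable_of_det_ne_zero e 1 v ?_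
  rw [Ne, ← Matrix.exists_mulVec_eq_zero_iff]
  rintro ⟨z, hz0, hz⟩
  have hA : ∀ j i, M.matA v j i = if R i j then 1 else 0 := by
    intro j i
    by_cases h : E j i
    · simp [StructuredSystem.matA, M, StructuredSystem.ofSteeringTarget, h, v]
    · simp [StructuredSystem.matA, M, StructuredSystem.ofSteeringTarget, h, mt (hRE i j) h]
  have hB : ∀ j i, M.matB v j i = if j = i then 1 else 0 := by
    intro j i
    by_cases h : j = i <;>
      simp [StructuredSystem.matB, M, StructuredSystem.ofSteeringTarget, h, v]
  have hC : ∀ j i, M.matC v j i = if i = j then 1 else 0 := by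
    intro j i
    by_cases h : i = j <;>
      simp [StructuredSystem.matC, M, StructuredSystem.ofSteeringTarget, h, v]
  have hzT : ∀ y ∈ T, z (Sum.inl y) = 0 := by
    intro y hy
    have := congrFun hz (Sum.inr ⟨y, hy⟩)
    simpa [Matrix.mulVec, dotProduct, Fintype.sum_sum_type, hC] using this
  -- With `s = 1` and entries `0`, `1`, a kernel vector takes at each state the sum of its values at
  -- the `R`-predecessors, plus the input value if the state is a start node.
  have hzX : ∀ j, z (Sum.inl j) = ∑ i, (if R i j then z (Sum.inl i) else 0) +
      ∑ y, if j = e y then z (Sum.inr y) else 0 := by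
    intro j
    have := congrFun hz (Sum.inl j)
    simp [Matrix.mulVec, dotProduct, Fintype.sum_sum_type, hA, hB, sub_mul,
      Finset.sum_sub_distrib, Matrix.one_apply] at this
    simp
    linarith
  have hpos : ∀ l ∈ L, ∀ l' ∈ L, ∀ (k k' : ℕ) w, l[k]? = some w → l'[k']? = some w →
      l = l' ∧ k = k' := by
    intro l hl l' hl' k k' w h h'
    obtain rfl := hdisj' l hl l' hl' w (List.mem_of_getElem? h) (List.mem_of_getElem? h')
    exact ⟨rfl, (List.getElem?_inj (List.getElem?_eq_some_iff.1 h).1 (hpath l hl).2.1).1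
      (h.trans h'.symm)⟩
  have hS' : ∀ l ∈ L, ∀ (k : ℕ) x, l[k + 1]? = some (Sum.inl x) → x ∉ S := by
    intro l hl k x h hx
    obtain ⟨l', hl', rfl⟩ := (hS x).1 hx
    have h0 := hs l' hl'
    rw [List.head?_eq_getElem?] at h0
    exact absurd (hpos l hl l' hl' _ _ _ h h0).2 (Nat.succ_ne_zero k)
  have hin : ∀ j ∉ S, ∑ y, (if j = e y then z (Sum.inr y) else 0) = 0 := fun j hj =>
    Finset.sum_eq_zero fun y _ => if_neg (by rintro rfl; exact hj (e y).2)
  -- Backwards along a path, by induction on the distance `d` from its end, which is a target.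
  have hzL : ∀ l ∈ L, ∀ (d k : ℕ) i, k + d + 1 = l.length → l[k]? = some (Sum.inl i) →
      z (Sum.inl i) = 0 := by
    intro l hl d
    induction d with
    | zero =>
      intro k i hk hi
      have h := ht l hl
      rw [List.getLast?_eq_getElem?, show l.length - 1 = k by omega, hi] at h
      rw [Sum.inl_injective (Option.some_injective _ h)]
      exact hzT _ (htT l hl)
    | succ d ih =>
      intro k i hk hi
      have hk' : k + 1 < l.length := by omega
      obtain ⟨j, hj⟩ := hinl l hl l[k + 1] (List.getElem_mem hk')
      have hj : l[k + 1]? = some (Sum.inl j) := by rw [List.getElem?_eq_getElem hk', hj]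
      have h1 := hzX j
      rw [ih (k + 1) j (by omega) hj, hin j (hS' l hl k j hj), add_zero,
        Finset.sum_eq_single i, if_pos ⟨l, hl, k, hi, hj⟩] at h1
      · exact h1.symm
      · rintro i' - hne
        refine if_neg ?_
        rintro ⟨l', hl', k', hi', hj'⟩
        obtain ⟨rfl, h2⟩ := hpos l hl l' hl' _ _ _ hj hj'
        obtain rfl : k = k' := by omega
        exact hne (Sum.inl_injective (Option.some_injective _ (hi'.symm.trans hi)))
      · simp
  have hzx : ∀ j, z (Sum.inl j) = 0 := by
    intro j
    by_cases hj : ∃ l ∈ L, Sum.inl j ∈ l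
    · obtain ⟨l, hl, hjl⟩ := hj
      obtain ⟨k, hk, hkj⟩ := List.mem_iff_getElem.1 hjl
      exact hzL l hl (l.length - (k + 1)) k j (by omega) (by rw [List.getElem?_eq_getElem hk, hkj])
    · rw [hzX, hin, add_zero]
      · refine Finset.sum_eq_zero fun i _ => if_neg ?_
        rintro ⟨l, hl, k, -, h⟩
        exact hj ⟨l, hl, List.mem_of_getElem? h⟩
      · intro h
        obtain ⟨l, hl, rfl⟩ := (hS j).1 h
        exact hj ⟨l, hl, hsmem l hl⟩
  refine hz0 (funext ?_)
  rintro (j | y)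
  · exact hzx j
  · have := hzX (e y)
    simpa [hzx, Subtype.coe_inj] using this.symm

/-! ### Solvability of the target controllability problem -/

theorem proposition2 {X : Type*} [Fintype X] (E : X → X → Prop) (Av T : Finset X) :
    (MTCPSolvable E Av T ↔
      ∃ L : Finset (List (X ⊕ Av ⊕ T)), IsAvailableTargetLinking E Av T L ∧ L.card = T.card) ∧
    (MTCPSolvable E Av T →
      ∃ S : Finset X, IsMTCPSolution E Av T S ∧ S.card = T.card) ∧
    (∀ L : Finset (List (X ⊕ Av ⊕ T)), IsAvailableTargetLinking E Av T L → L.card = T.card →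
      ∃ S : Finset X, Sum.inl '' (S : Set X) = startNodes L ∧
        IsMTCPSolution E Av T S ∧ S.card = T.card) := by
  have hstart : ∀ L : Finset (List (X ⊕ Av ⊕ T)), IsAvailableTargetLinking E Av T L →
      L.card = T.card → ∃ S : Finset X, Sum.inl '' (S : Set X) = startNodes L ∧
        IsMTCPSolution E Av T S ∧ S.card = T.card := by
    intro L hL hcard
    obtain ⟨S, hS, hadm, hScard⟩ := hL.exists_admissible hcard
    exact ⟨S, hS, ⟨hadm, fun S' hS' => hScard ▸ hS'.card_le⟩, hScard⟩
  have hlink : MTCPSolvable E Av T →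
      ∃ L : Finset (List (X ⊕ Av ⊕ T)), IsAvailableTargetLinking E Av T L ∧ L.card = T.card :=
    fun ⟨_, hS⟩ => hS.1.exists_linking
  refine ⟨⟨hlink, fun ⟨L, hL, hcard⟩ => ?_⟩, fun h => ?_, hstart⟩
  · obtain ⟨S, -, hS, -⟩ := hstart L hL hcard
    exact ⟨S, hS⟩
  · obtain ⟨L, hL, hcard⟩ := hlink h
    obtain ⟨S, -, hS⟩ := hstart L hL hcard
    exact ⟨S, hS⟩
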